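/- There is an absolute constant $A_->1$ such that for every $q\ge 1$ there are constants $L\ge\lambda>0$ and $K_->0$, depending only on $q$, for which the following holds. For every real $d\ge 1$ there is a compact doubling metric space $(\mathcal X_0,\mathcal D_0)$ such that: 1. the doubling dimension of $(\mathcal X_0,\mathcal D_0)$ is $\lfloor d\rfloor$. Here the doubling dimension is $\log_2 N$, where $N$ is the least integer such that every closed ball of radius $r>0$ can be covered by $N$ closed balls of radius $r/2$; 2. for all integers $M\ge 1$ and $T\ge M$, and for every (possibly randomized) policy $\pi$ for the $T$-step game that uses at most $M$ rounds of communication with an adaptively chosen grid $0=t_0\le t_1\le\dots\le t_M=T$, there is a nondegenerate bandit instance over $(\mathcal X_0,\mathcal D_0)$ with parameters $\lambda,L,q$ on which $$\mathbb E\big[R^\pi(T)\big]\;\ge\;K_-\,A_-^{\lfloor d\rfloor}\cdot\frac1{M^2}\cdot T^{\frac12\cdot\frac1{1-2^{-M}}} .$$ Here a nondegenerate bandit instance with parameters $\lambda,L,q$ consists of a (Borel) expected loss function $f:\mathcal X_0\to\mathbb R$ with a unique minimizer $\mathbf x^*$ such that $\lambda\,\mathcal D_0(\mathbf x,\mathbf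 x^*)^q\le f(\mathbf x)-f(\mathbf x^*)\le L\,\mathcal D_0(\mathbf x,\mathbf x^*)^q$ for all $\mathbf x\in\mathcal X_0$, and of a mean-zero 1-sub-Gaussian noise distribution. Playing $\mathbf x_t$ at step $t$ generates the loss sample $y_t=f(\mathbf x_t)+\xi_t$, where $\xi_1,\dots,\xi_T$ are i.i.d. with the noise distribution and independent of the internal randomization of the policy. The communication point $t_j$ and the points $\mathbf x_t$ with $t_{j-1}<t\le t_j$ depend only on the loss samples of the first $t_{j-1}$ steps and on the internal randomization. The regret is $R^\pi(T)=\sum_{t=1}^T\big(f(\mathbf x_t)-f(\mathbf x^*)\big)$. -/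

import Mathlib

open MeasureTheory ProbabilityTheory

noncomputable section

/-- In `X`, every closed ball of radius `r > 0` can be covered by (at most) `N` closed balls of
radius `r / 2`. -/
def DoublingWith (X : Type*) [MetricSpace X] (N : ℕ) : Prop :=
  ∀ (x : X) (r : ℝ), 0 < r →
    ∃ c : Finset X, c.card ≤ N ∧
      Metric.closedBall x r ⊆ ⋃ z ∈ c, Metric.closedBall z (r / 2)

/-- A metric space is doubling if its doubling constant is finite. -/
def IsDoubling (X : Type*) [MetricSpace X] : Prop := ∃ N : ℕ, DoublingWith X N

/-- The doubling constant: the minimal admissible `N` (meaningful for doubling spaces). -/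
def doublingConstant (X : Type*) [MetricSpace X] : ℕ := sInf {N : ℕ | DoublingWith X N}

/-- The doubling dimension `log₂ N`, with `N` the doubling constant. -/
def doublingDim (X : Type*) [MetricSpace X] : ℝ := Real.logb 2 (doublingConstant X)

/-- `f` attains its unique minimum at `xs` and is nondegenerate with parameters `lam`, `L`, `q`. -/
structure IsNondegenerateAt {X : Type*} [MetricSpace X] (f : X → ℝ) (xs : X) (lam L q : ℝ) :
    Prop where
  lam_pos : 0 < lam
  lam_le : lam ≤ L
  one_le_q : 1 ≤ q
  unique_min : ∀ x, x ≠ xs → f xs < f x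
  lower : ∀ x, lam * dist x xs ^ q ≤ f x - f xs
  upper : ∀ x, f x - f xs ≤ L * dist x xs ^ q

/-- A stochastic bandit instance over `X`: an expected loss function that is nondegenerate with
parameters `lam`, `L`, `q`, and a mean-zero 1-sub-Gaussian noise distribution. -/
structure NondegenerateInstance (X : Type*) [MetricSpace X] [MeasurableSpace X]
    (lam L q : ℝ) where
  loss : X → ℝ
  opt : X
  measurable_loss : Measurable loss
  nondegenerate : IsNondegenerateAt loss opt lam L q
  noise : Measure ℝ
  isProbabilityMeasure_noise : IsProbabilityMeasure noise
  noise_mean : ∫ z, z ∂noise = 0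
  noise_subGaussian : HasSubgaussianMGF (fun z : ℝ => z) 1 noise

/-- A (possibly randomized) policy for the `T`-step game with at most `M` rounds of communication
and an adaptively chosen grid `0 = t_0 ≤ t_1 ≤ ⋯ ≤ t_M = T`.

`Seed` carries the internal randomness of the policy. A vector `y : Fin T → ℝ` is a sequence of
loss samples, `y s` being the sample of step `s + 1`; `grid u y j` is the communication point
`t_j`, and `action u y s` is the point played at step `s + 1`. The adaptedness conditions say
that `t_{j+1}`, and every point played in the batch `(t_j, t_{j+1}]`, depend on the seed and on
the first `t_j` loss samples only. -/
structure BatchedPolicy (X : Type*) [MeasurableSpace X] (T M : ℕ) where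
  Seed : Type
  measurableSpaceSeed : MeasurableSpace Seed
  seedLaw : Measure Seed
  isProbabilityMeasure_seedLaw : IsProbabilityMeasure seedLaw
  grid : Seed → (Fin T → ℝ) → ℕ → ℕ
  action : Seed → (Fin T → ℝ) → Fin T → X
  measurable_grid : ∀ j, Measurable fun p : Seed × (Fin T → ℝ) => grid p.1 p.2 j
  measurable_action : ∀ s, Measurable fun p : Seed × (Fin T → ℝ) => action p.1 p.2 s
  grid_zero : ∀ u y, grid u y 0 = 0
  grid_mono : ∀ u y j, j < M → grid u y j ≤ grid u y (j + 1)
  grid_last : ∀ u y, grid u y M = T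
  grid_adapted : ∀ u y y' j, j < M →
    (∀ s : Fin T, (s : ℕ) < grid u y j → y s = y' s) →
      grid u y (j + 1) = grid u y' (j + 1)
  action_adapted : ∀ u y y' j, j < M → ∀ t : Fin T,
    grid u y j ≤ (t : ℕ) → (t : ℕ) < grid u y (j + 1) →
    (∀ s : Fin T, (s : ℕ) < grid u y j → y s = y' s) →
      action u y t = action u y' t

attribute [instance] BatchedPolicy.measurableSpaceSeed
attribute [instance] BatchedPolicy.isProbabilityMeasure_seedLaw
attribute [instance] NondegenerateInstance.isProbabilityMeasure_noise

namespace BatchedPolicy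

variable {X : Type*} [MeasurableSpace X] {T M : ℕ}

/-- The loss samples generated in the first `n` steps (padded by zeros) when the policy is run
with seed `u` against the expected loss `f` and the noise sequence `z`. -/
def lossesUpTo (π : BatchedPolicy X T M) (f : X → ℝ) (u : π.Seed) (z : Fin T → ℝ) :
    ℕ → (Fin T → ℝ)
  | 0 => fun _ => 0
  | n + 1 =>
    if h : n < T then
      Function.update (lossesUpTo π f u z n) ⟨n, h⟩
        (f (π.action u (lossesUpTo π f u z n) ⟨n, h⟩) + z ⟨n, h⟩)
    else lossesUpTo π f u z n

/-- The loss samples `y_1, …, y_T` of the whole run. -/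
def losses (π : BatchedPolicy X T M) (f : X → ℝ) (u : π.Seed) (z : Fin T → ℝ) : Fin T → ℝ :=
  π.lossesUpTo f u z T

/-- The points `x_1, …, x_T` played in the run. -/
def played (π : BatchedPolicy X T M) (f : X → ℝ) (u : π.Seed) (z : Fin T → ℝ) : Fin T → X :=
  π.action u (π.losses f u z)

end BatchedPolicy

/-- The expected `T`-step regret `E[∑_t (f(x_t) - f(x^*))]` of running the policy `π` on the
instance `I`: the seed and the `T` noise variables are independent, the latter i.i.d. with
distribution `I.noise`. -/
def expectedRegret {X : Type*} [MetricSpace X] [MeasurableSpace X] {T M : ℕ} {lam L q : ℝ}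
    (π : BatchedPolicy X T M) (I : NondegenerateInstance X lam L q) : ℝ :=
  ∫ p : π.Seed × (Fin T → ℝ),
    ∑ t : Fin T, (I.loss (π.played I.loss p.1 p.2 t) - I.loss I.opt)
    ∂(π.seedLaw.prod (Measure.pi fun _ : Fin T => I.noise))

end

/-! The space is the cube `[-2ⁿ, 2ⁿ]ⁿ` with the sup metric, `n = ⌊d⌋`. Let `o` be its centre. The
`2ⁿ` points `a` with coordinates `±ρ` lie at distance `ρ` from `o`, and the open balls of radius `ρ`
around them are disjoint. The reference loss is `dist x o ^ q`; `bumpLoss` alters it on one of these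
balls so that the minimum moves to `a`.

For any thresholds `b` with `b M ≤ T`, every run has an index `i < M` with `t_i ≤ b i` and `b (i+1)
≤ t_{i+1}`, so under the reference loss some fixed `i` occurs with probability at least `1/M`
(`exists_le_measureReal_longBatch`). On that event all of the first `b (i+1)` actions are determined
by at most `b i` losses, and at most one ball receives more than half of these actions. Since the
balls are disjoint, the information about the location of the bump gathered in `b i` steps is shared
among `2ⁿ` candidates. If `ρ ^ (2q) * b i` is of order `2ⁿ / M`, a change of measure
(`measureReal_run_preimage_le`) shows that for some `a` the policy misses the ball of `a` in half of
the `b (i+1)` steps with probability of order `1/M` under the loss of `a` itself, and each miss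
costs at least `ρ ^ q` (`exists_le_expectedRegret`).

The regret is thus of order `b (i+1) * ρ ^ q / M`, with `ρ ^ q` of order `√2 ^ n / √(M * b i)`. The
cutoffs make `b (i+1) / √(b i)` essentially independent of `i` (`cutoff_succ`), which yields the
exponent of `T` and `A = √2`. -/

noncomputable section

/-! ### Resampling a coordinate and shifting one Gaussian -/

/-- Resampling one coordinate preserves a product of probability measures. -/
lemma measurePreserving_update {ι : Type*} [Fintype ι] [DecidableEq ι] {α : ι → Type*}
    [∀ i, MeasurableSpace (α i)] (μ : ∀ i, Measure (α i)) [∀ i, IsProbabilityMeasure (μ i)]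
    (i : ι) :
    MeasurePreserving (fun p : (∀ j, α j) × α i => Function.update p.1 i p.2)
      ((Measure.pi μ).prod (μ i)) (Measure.pi μ) := by
  refine ⟨measurable_update', ?_⟩
  symm
  refine Measure.pi_eq fun s hs => ?_
  rw [Measure.map_apply measurable_update' (MeasurableSet.univ_pi hs)]
  have : (fun p : (∀ j, α j) × α i => Function.update p.1 i p.2) ⁻¹' (Set.univ.pi s) =
      (Set.univ.pi (Function.update s i Set.univ)) ×ˢ s i := by
    ext ⟨x, a⟩
    simp only [Set.mem_preimage, Set.mem_pi, Set.mem_univ, forall_const, Set.mem_prod]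
    constructor
    · intro h
      refine ⟨fun j => ?_, by simpa using h i⟩
      by_cases hj : j = i
      · subst hj; simp
      · simpa [hj] using h j
    · rintro ⟨h, h'⟩ j
      by_cases hj : j = i
      · subst hj; simpa using h'
      · simpa [hj] using h j
  rw [this, Measure.prod_prod, Measure.pi_pi, ← Finset.mul_prod_erase _ _ (Finset.mem_univ i),
    ← Finset.mul_prod_erase Finset.univ (fun j => μ j (s j)) (Finset.mem_univ i)]
  simp only [Function.update_self, measure_univ, one_mul]
  rw [mul_comm]
  congr 1
  refine Finset.prod_congr rfl fun j hj => ?_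
  rw [Function.update_of_ne (Finset.ne_of_mem_erase hj)]

/-- The Gaussian shift formula. -/
lemma lintegral_sub_mul_exp_gaussianReal (c : ℝ) {h : ℝ → ENNReal} (hh : Measurable h) :
    ∫⁻ x, h (x - c) * ENNReal.ofReal (Real.exp (c * x - c ^ 2 / 2)) ∂gaussianReal 0 1 =
      ∫⁻ x, h x ∂gaussianReal 0 1 := by
  rw [gaussianReal_of_var_ne_zero _ one_ne_zero,
    lintegral_withDensity_eq_lintegral_mul _ (measurable_gaussianPDF 0 1) (by fun_prop),
    lintegral_withDensity_eq_lintegral_mul _ (measurable_gaussianPDF 0 1) hh,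
    ← lintegral_sub_right_eq_self (fun x => (gaussianPDF 0 1 * h) x) c]
  refine lintegral_congr fun x => ?_
  simp only [Pi.mul_apply, gaussianPDF]
  rw [mul_left_comm, mul_comm _ (h _), ← ENNReal.ofReal_mul (gaussianPDFReal_nonneg _ _ _)]
  congr 2
  simp only [gaussianPDFReal, mul_assoc, ← Real.exp_add]
  congr 2
  simp
  ring

/-! ### Change of measure for predictable shifts of Gaussian noise -/

section Girsanov

variable {T : ℕ}

/-- The law of `T` independent standard Gaussian variables. -/
abbrev stdGaussianPi (T : ℕ) : Measure (Fin T → ℝ) := Measure.pi fun _ => gaussianReal 0 1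

/-- As `c` ignores coordinate `t`, resampling that coordinate freezes `c`, and Fubini reduces the
claim to the one-dimensional shift by a constant. -/
lemma lintegral_update_sub_mul_exp (t : Fin T) {G : (Fin T → ℝ) → ENNReal} (hG : Measurable G)
    {c : (Fin T → ℝ) → ℝ} (hc : Measurable c) (hct : ∀ z s, c (Function.update z t s) = c z) :
    ∫⁻ z, G (Function.update z t (z t - c z)) *
        ENNReal.ofReal (Real.exp (c z * z t - c z ^ 2 / 2)) ∂stdGaussianPi T =
      ∫⁻ z, G z ∂stdGaussianPi T := by
  have hU : MeasurePreserving (fun p : (Fin T → ℝ) × ℝ => Function.update p.1 t p.2)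
      ((stdGaussianPi T).prod (gaussianReal 0 1)) (stdGaussianPi T) :=
    measurePreserving_update (fun _ : Fin T => gaussianReal 0 1) t
  have hupd : Measurable fun z : Fin T → ℝ => Function.update z t (z t - c z) :=
    measurable_update'.comp (measurable_id.prodMk ((measurable_pi_apply t).sub hc))
  have hzt : Measurable fun z : Fin T → ℝ => z t := measurable_pi_apply t
  have hF : Measurable fun z : Fin T → ℝ => G (Function.update z t (z t - c z)) *
      ENNReal.ofReal (Real.exp (c z * z t - c z ^ 2 / 2)) :=
    (hG.comp hupd).mul (by fun_prop)
  rw [← hU.lintegral_comp hF, ← hU.lintegral_comp hG,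
    lintegral_prod _ (by exact (hF.comp hU.measurable).aemeasurable),
    lintegral_prod _ (by exact (hG.comp hU.measurable).aemeasurable)]
  refine lintegral_congr fun z => ?_
  simp only [hct, Function.update_self, Function.update_idem]
  exact lintegral_sub_mul_exp_gaussianReal (c z)
    (h := fun s => G (Function.update z t s)) (hG.comp (measurable_update z))

/-- A martingale increment: with `c` frozen by resampling coordinate `t`, the inner integral is a
centred Gaussian mean. It removes the linear terms from the expected log-likelihood. -/
lemma integral_mul_apply_eq_zero (t : Fin T) {c : (Fin T → ℝ) → ℝ} (hc : Measurable c)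
    (hct : ∀ z s, c (Function.update z t s) = c z) {C : ℝ} (hC : ∀ z, |c z| ≤ C) :
    Integrable (fun z => c z * z t) (stdGaussianPi T) ∧
      ∫ z, c z * z t ∂stdGaussianPi T = 0 := by
  have hU : MeasurePreserving (fun p : (Fin T → ℝ) × ℝ => Function.update p.1 t p.2)
      ((stdGaussianPi T).prod (gaussianReal 0 1)) (stdGaussianPi T) :=
    measurePreserving_update (fun _ : Fin T => gaussianReal 0 1) t
  have hid : Integrable (fun x : ℝ => x) (gaussianReal 0 1) :=
    (memLp_id_gaussianReal 1).integrable (by simp)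
  have hzt : Integrable (fun z : Fin T → ℝ => z t) (stdGaussianPi T) :=
    (measurePreserving_eval (fun _ : Fin T => gaussianReal 0 1) t).integrable_comp_of_integrable hid
  have hint : Integrable (fun z => c z * z t) (stdGaussianPi T) :=
    hzt.bdd_mul hc.aestronglyMeasurable (.of_forall hC)
  refine ⟨hint, ?_⟩
  rw [← hU.map_eq, integral_map hU.measurable.aemeasurable
    (by rw [hU.map_eq]; exact hint.aestronglyMeasurable)]
  simp only [hct, Function.update_self]
  rw [integral_prod _ (by simpa [Function.comp_def, hct] using hU.integrable_comp_of_integrable hint)]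
  have h0 (a : ℝ) : ∫ s, a * s ∂gaussianReal 0 1 = 0 := by
    rw [MeasureTheory.integral_const_mul, integral_id_gaussianReal, mul_zero]
  simp [h0]

/-- Subtract the predictable drift `g` from the first `n` coordinates. -/
def subDrift (g : Fin T → (Fin T → ℝ) → ℝ) (n : ℕ) (z : Fin T → ℝ) : Fin T → ℝ :=
  fun t => if (t : ℕ) < n then z t - g t z else z t

/-- The logarithm of the likelihood ratio corresponding to `subDrift`. -/
def logLikelihood (g : Fin T → (Fin T → ℝ) → ℝ) (n : ℕ) (z : Fin T → ℝ) : ℝ :=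
  ∑ t : Fin T, if (t : ℕ) < n then g t z * z t - g t z ^ 2 / 2 else 0

/-- `g` is predictable: `g t` depends on the coordinates before `t` only. -/
def Predictable (g : Fin T → (Fin T → ℝ) → ℝ) : Prop :=
  ∀ t z z', (∀ s : Fin T, s < t → z s = z' s) → g t z = g t z'

variable {g : Fin T → (Fin T → ℝ) → ℝ}

lemma Predictable.update (hg : Predictable g) {t s : Fin T} (h : t ≤ s) (z : Fin T → ℝ) (a : ℝ) :
    g t (Function.update z s a) = g t z :=
  hg _ _ _ fun _ hr => Function.update_of_ne (hr.trans_le h).ne _ _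

lemma measurable_subDrift (hm : ∀ t, Measurable (g t)) (n : ℕ) : Measurable (subDrift g n) := by
  refine measurable_pi_lambda _ fun t => ?_
  have := hm t
  unfold subDrift
  split_ifs <;> fun_prop

lemma measurable_logLikelihood (hm : ∀ t, Measurable (g t)) (n : ℕ) :
    Measurable (logLikelihood g n) := by
  refine Finset.measurable_sum _ fun t _ => ?_
  have := hm t
  split_ifs <;> fun_prop

/-- The last shift can be performed first: by predictability, altering coordinate `n` changes none
of the drifts at times up to `n`. -/
lemma subDrift_succ (hg : Predictable g) {n : ℕ} (h : n < T) (z : Fin T → ℝ) :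
    subDrift g (n + 1) z =
      subDrift g n (Function.update z ⟨n, h⟩ (z ⟨n, h⟩ - g ⟨n, h⟩ z)) := by
  ext t
  rcases lt_trichotomy (t : ℕ) n with ht | ht | ht
  · have hne : t ≠ ⟨n, h⟩ := by rintro rfl; simp at ht
    have hle : t ≤ ⟨n, h⟩ := Fin.le_def.2 ht.le
    simp [subDrift, ht, ht.trans (Nat.lt_succ_self n), hg.update hle, hne]
  · obtain rfl : t = ⟨n, h⟩ := Fin.ext ht
    simp [subDrift]
  · have hne : t ≠ ⟨n, h⟩ := by rintro rfl; simp at ht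
    simp [subDrift, hne, ht.not_gt, (Nat.succ_le_of_lt ht).not_gt]

lemma logLikelihood_succ {n : ℕ} (h : n < T) (z : Fin T → ℝ) :
    logLikelihood g (n + 1) z = logLikelihood g n z +
      (g ⟨n, h⟩ z * z ⟨n, h⟩ - g ⟨n, h⟩ z ^ 2 / 2) := by
  have : (g ⟨n, h⟩ z * z ⟨n, h⟩ - g ⟨n, h⟩ z ^ 2 / 2) =
      ∑ t : Fin T, if t = ⟨n, h⟩ then g t z * z t - g t z ^ 2 / 2 else 0 := by simp
  rw [this, logLikelihood, logLikelihood, ← Finset.sum_add_distrib]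
  refine Finset.sum_congr rfl fun t _ => ?_
  rcases lt_trichotomy (t : ℕ) n with ht | ht | ht
  · have hne : t ≠ ⟨n, h⟩ := by rintro rfl; simp at ht
    simp [ht, ht.trans (Nat.lt_succ_self n), hne]
  · obtain rfl : t = ⟨n, h⟩ := Fin.ext ht
    simp
  · have hne : t ≠ ⟨n, h⟩ := by rintro rfl; simp at ht
    simp [hne, ht.not_gt, (Nat.succ_le_of_lt ht).not_gt]

lemma logLikelihood_update (hg : Predictable g) {n : ℕ} (h : n < T) (z : Fin T → ℝ) (a : ℝ) :
    logLikelihood g n (Function.update z ⟨n, h⟩ a) = logLikelihood g n z := by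
  refine Finset.sum_congr rfl fun t _ => ?_
  split_ifs with ht
  · have hne : t ≠ ⟨n, h⟩ := by rintro rfl; simp at ht
    rw [hg.update (Fin.le_def.2 ht.le), Function.update_of_ne hne]
  · rfl

/-- Discrete Girsanov theorem for predictable shifts of Gaussian noise. -/
theorem lintegral_subDrift_mul_exp (hg : Predictable g) (hm : ∀ t, Measurable (g t)) (n : ℕ)
    {H : (Fin T → ℝ) → ENNReal} (hH : Measurable H) :
    ∫⁻ z, H (subDrift g n z) * ENNReal.ofReal (Real.exp (logLikelihood g n z)) ∂stdGaussianPi T =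
      ∫⁻ z, H z ∂stdGaussianPi T := by
  induction n with
  | zero =>
    have : ∀ z, subDrift g 0 z = z := fun z => by ext t; simp [subDrift]
    simp [this, logLikelihood]
  | succ n ih =>
    by_cases h : n < T
    · rw [← ih]
      -- The single shift at time `n` is applied to the whole integrand for `n` shifts; its
      -- likelihood factor does not see coordinate `n`.
      refine Eq.trans ?_ (lintegral_update_sub_mul_exp ⟨n, h⟩ (c := g ⟨n, h⟩)
        ((hH.comp (measurable_subDrift hm n)).mul
          (measurable_logLikelihood hm n).exp.ennreal_ofReal) (hm _)
        (fun z s => hg.update le_rfl z s))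
      refine lintegral_congr fun z => ?_
      simp only [Pi.mul_apply, Function.comp_apply]
      rw [subDrift_succ hg h, logLikelihood_succ h, Real.exp_add,
        ENNReal.ofReal_mul (Real.exp_pos _).le, logLikelihood_update hg h, mul_assoc]
    · rw [← ih]
      have hlt : ∀ t : Fin T, (t : ℕ) < n + 1 ∧ (t : ℕ) < n := fun t => by omega
      refine lintegral_congr fun z => ?_
      have : subDrift g (n + 1) z = subDrift g n z := by ext t; simp [subDrift, hlt]
      simp [this, logLikelihood, hlt]

/-- Change of measure: an event that is likely under the shifted noise is likely under the original
noise, provided that the expected squared drift is small. -/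
theorem measureReal_subDrift_preimage_le (hg : Predictable g) (hm : ∀ t, Measurable (g t))
    {C : ℝ} (hC : ∀ t z, |g t z| ≤ C) (n : ℕ) {S : Set (Fin T → ℝ)} (hS : MeasurableSet S) :
    (stdGaussianPi T).real (subDrift g n ⁻¹' S) -
        (∫ z, ∑ t : Fin T, (if (t : ℕ) < n then g t z ^ 2 else 0) ∂stdGaussianPi T) / 2 ≤
      (Real.exp 1 - 1) * (stdGaussianPi T).real S := by
  set P := stdGaussianPi T
  set Λ : (Fin T → ℝ) → ℝ := fun z => Real.exp (logLikelihood g n z) with hΛ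
  have hΛm : Measurable Λ := (measurable_logLikelihood hm n).exp
  have hDm := measurable_subDrift hm n
  have hint (S : Set (Fin T → ℝ)) (hS : MeasurableSet S) :
      ∫⁻ z in subDrift g n ⁻¹' S, ENNReal.ofReal (Λ z) ∂P = P S := by
    rw [← lintegral_indicator (hDm hS), ← lintegral_indicator_one hS,
      ← lintegral_subDrift_mul_exp hg hm n (measurable_one.indicator hS)]
    refine lintegral_congr fun z => ?_
    by_cases hz : subDrift g n z ∈ S <;> simp [Set.indicator, hz, hΛ]
  have hΛi : Integrable Λ P := by
    refine ⟨hΛm.aestronglyMeasurable, ?_⟩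
    rw [hasFiniteIntegral_iff_ofReal (.of_forall fun z => (Real.exp_pos _).le)]
    have := hint Set.univ .univ
    simp only [Set.preimage_univ, Measure.restrict_univ, measure_univ] at this
    rw [this]; simp
  have hΛS (S : Set (Fin T → ℝ)) (hS : MeasurableSet S) :
      ∫ z in subDrift g n ⁻¹' S, Λ z ∂P = P.real S := by
    rw [integral_eq_lintegral_of_nonneg_ae (.of_forall fun z => (Real.exp_pos _).le)
      hΛm.aestronglyMeasurable, hint S hS, Measure.real]
  have hΛ1 : ∫ z, Λ z ∂P = 1 := by simpa using hΛS Set.univ .univ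
  have hsq (t : Fin T) : Integrable (fun z => g t z ^ 2) P := by
    refine Integrable.of_bound ((hm t).pow_const 2).aestronglyMeasurable (C ^ 2)
      (.of_forall fun z => ?_)
    rw [Real.norm_eq_abs, abs_pow]
    exact pow_le_pow_left₀ (abs_nonneg _) (hC t z) 2
  have hlin (t : Fin T) := integral_mul_apply_eq_zero t (hm t)
    (fun z s => hg.update le_rfl z s) (hC t)
  have hli (t : Fin T) : Integrable
      (fun z => if (t : ℕ) < n then g t z * z t - g t z ^ 2 / 2 else 0) P := by
    split_ifs
    · exact (hlin t).1.sub ((hsq t).div_const 2)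
    · exact integrable_zero _ _ _
  have hlogi : Integrable (logLikelihood g n) P := integrable_finsetSum _ fun t _ => hli t
  have hlog : ∫ z, logLikelihood g n z ∂P =
      -(∫ z, ∑ t : Fin T, (if (t : ℕ) < n then g t z ^ 2 else 0) ∂P) / 2 := by
    simp only [logLikelihood]
    rw [integral_finsetSum _ fun t _ => hli t, integral_finsetSum, ← Finset.sum_neg_distrib,
      Finset.sum_div]
    · refine Finset.sum_congr rfl fun t _ => ?_
      split_ifs
      · rw [integral_sub (hlin t).1 ((hsq t).div_const 2), (hlin t).2, integral_div]
        ring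
      · simp
    · intro t _
      split_ifs
      · exact hsq t
      · exact integrable_zero _ _ _
  set D := subDrift g n ⁻¹' S
  -- Two tangent bounds for the logarithm: `log Λ ≤ e Λ - 2` on `D` and `log Λ ≤ Λ - 1` off `D`.
  -- Integrated, with `∫ Λ = 1` and `∫_D Λ = P(S)`, they bound `P(D)` by half the expected squared
  -- drift plus `(e - 1) P(S)`.
  have hpt (z) : logLikelihood g n z ≤
      (Λ z - 1) + D.indicator (fun z => (Real.exp 1 - 1) * Λ z - 1) z := by
    by_cases hz : z ∈ D
    · rw [Set.indicator_of_mem hz]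
      have := Real.add_one_le_exp (logLikelihood g n z + 1)
      rw [Real.exp_add] at this
      simp only [hΛ]; linarith
    · rw [Set.indicator_of_notMem hz]
      have := Real.add_one_le_exp (logLikelihood g n z)
      simp only [hΛ]; linarith
  have hDi : Integrable (fun z => (Real.exp 1 - 1) * Λ z - 1) P :=
    (hΛi.const_mul _).sub (integrable_const 1)
  have key := integral_mono hlogi ((hΛi.sub (integrable_const 1)).add (hDi.indicator (hDm hS))) hpt
  have e1 : ∫ z, ((Λ z - 1) + D.indicator (fun z => (Real.exp 1 - 1) * Λ z - 1) z) ∂P =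
      (Real.exp 1 - 1) * P.real S - P.real D := by
    rw [integral_add (by exact hΛi.sub (integrable_const 1)) (hDi.indicator (hDm hS)),
      integral_sub hΛi (integrable_const 1), hΛ1, integral_indicator (hDm hS),
      integral_sub (hΛi.const_mul _).integrableOn (integrable_const 1).integrableOn,
      integral_const_mul, hΛS S hS]
    simp [D, Measure.real]
  have key' := key.trans_eq e1
  rw [hlog] at key'
  linarith

end Girsanov

/-! ### Runs of a batched policy, and long batches -/

namespace BatchedPolicy

variable {X : Type*} [MeasurableSpace X] {T M : ℕ} (π : BatchedPolicy X T M)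

lemma exists_batch (u : π.Seed) (y : Fin T → ℝ) {t : ℕ} (ht : t < T) :
    ∃ j < M, π.grid u y j ≤ t ∧ t < π.grid u y (j + 1) := by
  classical
  have hex : ∃ j, t < π.grid u y j := ⟨M, by rwa [π.grid_last]⟩
  have hspec := Nat.find_spec hex
  have hle : Nat.find hex ≤ M := Nat.find_min' hex (by rwa [π.grid_last])
  rcases hj : Nat.find hex with _ | j
  · rw [hj, π.grid_zero] at hspec
    exact absurd hspec (Nat.not_lt_zero t)
  · rw [hj] at hspec hle
    exact ⟨j, hle, not_lt.1 (Nat.find_min hex (hj ▸ Nat.lt_succ_self j)), hspec⟩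

/-- The point played at step `t + 1` depends on the losses of the first `t` steps only. -/
lemma action_congr {u : π.Seed} {y y' : Fin T → ℝ} {t : Fin T}
    (h : ∀ s : Fin T, s < t → y s = y' s) : π.action u y t = π.action u y' t := by
  obtain ⟨j, hj, h1, h2⟩ := π.exists_batch u y t.2
  exact π.action_adapted u y y' j hj t h1 h2 fun s hs => h s (Fin.lt_def.2 (hs.trans_le h1))

section Losses

variable (f : X → ℝ) (u : π.Seed) (z : Fin T → ℝ)

lemma lossesUpTo_of_lt {m : ℕ} {s : Fin T} (h : (s : ℕ) < m) :
    π.lossesUpTo f u z m s = π.losses f u z s := by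
  have key : ∀ m, (s : ℕ) + 1 ≤ m → π.lossesUpTo f u z m s = π.lossesUpTo f u z (s + 1) s := by
    intro m hm
    induction m, hm using Nat.le_induction with
    | base => rfl
    | succ m hm ih =>
      rw [← ih, lossesUpTo]
      split_ifs with hT
      · exact Function.update_of_ne (by rintro rfl; simp at hm) _ _
      · rfl
  rw [losses, key m h, key T s.2]

lemma losses_apply (t : Fin T) :
    π.losses f u z t = f (π.played f u z t) + z t := by
  rw [← π.lossesUpTo_of_lt f u z (Nat.lt_succ_self t), lossesUpTo, dif_pos t.2]
  simp only [Fin.eta, Function.update_self]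
  rw [played, π.action_congr fun s hs => π.lossesUpTo_of_lt f u z (Fin.lt_def.1 hs)]

variable {f u z}

/-- The recursion defining the losses has a unique solution up to time `m`. Runs under different
noises or losses are identified by checking that recursion. -/
lemma eq_losses_of_lt {y : Fin T → ℝ} {m : ℕ}
    (h : ∀ t : Fin T, (t : ℕ) < m → y t = f (π.action u y t) + z t) {t : Fin T}
    (ht : (t : ℕ) < m) : y t = π.losses f u z t := by
  induction t using WellFoundedLT.induction with
  | ind t ih =>
    rw [h t ht, losses_apply, played,
      π.action_congr fun s hs => ih s hs ((Fin.lt_def.1 hs).trans ht)]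

lemma played_congr {z' : Fin T → ℝ} {t : Fin T} (h : ∀ s : Fin T, s < t → z s = z' s) :
    π.played f u z t = π.played f u z' t := by
  refine π.action_congr fun s hs => π.eq_losses_of_lt (m := t) (fun r hr => ?_) (Fin.lt_def.1 hs)
  rw [losses_apply, h r (Fin.lt_def.2 hr), played]

end Losses

lemma measurable_losses {f : X → ℝ} (hf : Measurable f) :
    Measurable fun p : π.Seed × (Fin T → ℝ) => π.losses f p.1 p.2 := by
  have key : ∀ n, Measurable fun p : π.Seed × (Fin T → ℝ) => π.lossesUpTo f p.1 p.2 n := by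
    intro n
    induction n with
    | zero => exact measurable_const
    | succ n ih =>
      simp only [lossesUpTo]
      split_ifs with h
      · have h1 := hf.comp ((π.measurable_action ⟨n, h⟩).comp (measurable_fst.prodMk ih))
        have h2 : Measurable fun p : π.Seed × (Fin T → ℝ) => p.2 ⟨n, h⟩ :=
          (measurable_pi_apply _).comp measurable_snd
        exact measurable_update'.comp (ih.prodMk (h1.add h2))
      · exact ih
  exact key T

lemma measurable_played {f : X → ℝ} (hf : Measurable f) (t : Fin T) :
    Measurable fun p : π.Seed × (Fin T → ℝ) => π.played f p.1 p.2 t :=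
  (π.measurable_action t).comp (measurable_fst.prodMk (π.measurable_losses hf))

/-- The law of the seed and of the standard Gaussian noise. -/
abbrev gaussianLaw : Measure (π.Seed × (Fin T → ℝ)) := π.seedLaw.prod (stdGaussianPi T)

/-- The run `(u, y)` of the policy, as a function of the seed and the noise. -/
def run (f : X → ℝ) (p : π.Seed × (Fin T → ℝ)) : π.Seed × (Fin T → ℝ) :=
  (p.1, π.losses f p.1 p.2)

lemma measurable_run {f : X → ℝ} (hf : Measurable f) : Measurable (π.run f) :=
  measurable_fst.prodMk (π.measurable_losses hf)

variable {f₀ f₁ : X → ℝ} {C : ℝ}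

lemma integrable_sum_sq (hf₀ : Measurable f₀) (hf₁ : Measurable f₁)
    (hC : ∀ x, |f₁ x - f₀ x| ≤ C) (n : ℕ) :
    Integrable (fun p : π.Seed × (Fin T → ℝ) => ∑ t : Fin T, if (t : ℕ) < n then
      (f₁ (π.played f₀ p.1 p.2 t) - f₀ (π.played f₀ p.1 p.2 t)) ^ 2 else 0) π.gaussianLaw := by
  refine integrable_finsetSum _ fun t _ => ?_
  split_ifs
  · refine Integrable.of_bound (C := C ^ 2) ?_ (.of_forall fun p => ?_)
    · have := π.measurable_played hf₀ t
      exact (((hf₁.comp this).sub (hf₀.comp this)).pow_const 2).aestronglyMeasurable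
    · rw [Real.norm_eq_abs, abs_pow]
      exact pow_le_pow_left₀ (abs_nonneg _) (hC _) 2
  · exact integrable_zero _ _ _

/-- Change of measure between two loss functions, for events determined by the first `n` losses. -/
theorem measureReal_run_preimage_le (hf₀ : Measurable f₀) (hf₁ : Measurable f₁)
    (hC : ∀ x, |f₁ x - f₀ x| ≤ C) (n : ℕ) {B : Set (π.Seed × (Fin T → ℝ))}
    (hB : MeasurableSet B)
    (hBn : ∀ u y y', (∀ s : Fin T, (s : ℕ) < n → y s = y' s) → (u, y) ∈ B → (u, y') ∈ B) :
    π.gaussianLaw.real (π.run f₀ ⁻¹' B) -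
        (∫ p, ∑ t : Fin T, (if (t : ℕ) < n then
          (f₁ (π.played f₀ p.1 p.2 t) - f₀ (π.played f₀ p.1 p.2 t)) ^ 2 else 0)
            ∂π.gaussianLaw) / 2 ≤
      (Real.exp 1 - 1) * π.gaussianLaw.real (π.run f₁ ⁻¹' B) := by
  have hE₀ := π.measurable_run hf₀ hB
  have hE₁ := π.measurable_run hf₁ hB
  have hV := π.integrable_sum_sq hf₀ hf₁ hC n
  have hI (E : Set (π.Seed × (Fin T → ℝ))) (hE : MeasurableSet E) :
      Integrable (E.indicator (1 : π.Seed × (Fin T → ℝ) → ℝ)) π.gaussianLaw :=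
    (integrable_const (1 : ℝ)).indicator hE
  have hreal (E : Set (π.Seed × (Fin T → ℝ))) (hE : MeasurableSet E) :
      π.gaussianLaw.real E = ∫ u, (stdGaussianPi T).real (Prod.mk u ⁻¹' E) ∂π.seedLaw := by
    rw [← integral_indicator_one hE, integral_prod _ (hI E hE)]
    refine integral_congr_ae (.of_forall fun u => ?_)
    simp only
    rw [← integral_indicator_one (measurable_prodMk_left hE)]
    rfl
  have hrealI (E : Set (π.Seed × (Fin T → ℝ))) (hE : MeasurableSet E) :
      Integrable (fun u => (stdGaussianPi T).real (Prod.mk u ⁻¹' E)) π.seedLaw := by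
    refine (hI E hE).integral_prod_left.congr (.of_forall fun u => ?_)
    simp only
    rw [← integral_indicator_one (measurable_prodMk_left hE)]
    rfl
  rw [hreal _ hE₀, hreal _ hE₁, integral_prod _ hV, ← integral_div, ← integral_const_mul,
    ← integral_sub (hrealI _ hE₀) (hV.integral_prod_left.div_const 2)]
  refine integral_mono ((hrealI _ hE₀).sub (hV.integral_prod_left.div_const 2))
    ((hrealI _ hE₁).const_mul _) fun u => ?_
  -- For a fixed seed the policy is deterministic, so the gap between the two losses at the played
  -- point is a predictable drift.
  set g : Fin T → (Fin T → ℝ) → ℝ :=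
    fun t z => f₁ (π.played f₀ u z t) - f₀ (π.played f₀ u z t) with hg
  have hpred : Predictable g := fun t z z' h => by simp only [hg, π.played_congr h]
  have hgm (t : Fin T) : Measurable (g t) := by
    have := (π.measurable_played hf₀ t).comp (measurable_prodMk_left (x := u))
    exact (hf₁.comp this).sub (hf₀.comp this)
  -- Moving the gap from the noise into the loss gives the same samples: the `f₁`-run with shifted
  -- noise agrees with the `f₀`-run up to time `n`, which is all that `B` sees.
  have hset : Prod.mk u ⁻¹' (π.run f₀ ⁻¹' B) =
      subDrift g n ⁻¹' (Prod.mk u ⁻¹' (π.run f₁ ⁻¹' B)) := by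
    ext z
    have heq : ∀ s : Fin T, (s : ℕ) < n →
        π.losses f₀ u z s = π.losses f₁ u (subDrift g n z) s := fun s hs => by
      refine π.eq_losses_of_lt (m := n) (fun t ht => ?_) hs
      rw [losses_apply]
      simp only [subDrift, ht, if_true, hg, played]
      ring
    exact ⟨hBn _ _ _ heq, hBn _ _ _ fun s hs => (heq s hs).symm⟩
  have := measureReal_subDrift_preimage_le hpred hgm (fun t z => hC _) n
    (measurable_prodMk_left (x := u) hE₁)
  rw [← hset] at this
  exact this

/-- The `i`-th communication happens at time at most `τ`, and the next one at time at least `n`. -/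
def longBatch (i τ n : ℕ) : Set (π.Seed × (Fin T → ℝ)) :=
  {p | π.grid p.1 p.2 i ≤ τ ∧ n ≤ π.grid p.1 p.2 (i + 1)}

lemma measurableSet_longBatch (i τ n : ℕ) : MeasurableSet (π.longBatch i τ n) :=
  (measurableSet_le (π.measurable_grid i) measurable_const).inter
    (measurableSet_le measurable_const (π.measurable_grid (i + 1)))

lemma grid_monotone (u : π.Seed) (y : Fin T → ℝ) {i j : ℕ} (hij : i ≤ j) (hj : j ≤ M) :
    π.grid u y i ≤ π.grid u y j := by
  induction j, hij using Nat.le_induction with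
  | base => rfl
  | succ j _ ih => exact (ih (by omega)).trans (π.grid_mono u y j (by omega))

/-- For any thresholds `b` that do not exceed the horizon, every run of the policy has a long batch. -/
lemma exists_mem_longBatch (hM : 1 ≤ M) {b : ℕ → ℕ} (hb : b M ≤ T)
    (p : π.Seed × (Fin T → ℝ)) : ∃ i < M, p ∈ π.longBatch i (b i) (b (i + 1)) := by
  classical
  have hlast : b (M - 1 + 1) ≤ π.grid p.1 p.2 (M - 1 + 1) := by
    rw [Nat.sub_add_cancel hM, π.grid_last]; exact hb
  -- The least such `i` works: minimality gives `t_i < b i`, except for `i = 0`, where `t_0 = 0`.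
  have hex : ∃ i, b (i + 1) ≤ π.grid p.1 p.2 (i + 1) := ⟨M - 1, hlast⟩
  have hle : Nat.find hex ≤ M - 1 := Nat.find_min' hex hlast
  refine ⟨Nat.find hex, by omega, ?_, Nat.find_spec hex⟩
  rcases hj : Nat.find hex with _ | j
  · rw [π.grid_zero]; exact Nat.zero_le _
  · exact (not_le.1 (Nat.find_min hex (hj ▸ Nat.lt_succ_self j))).le

lemma exists_le_measureReal_longBatch (hM : 1 ≤ M) {b : ℕ → ℕ} (hb : b M ≤ T) {f : X → ℝ} :
    ∃ i < M, 1 / (M : ℝ) ≤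
      π.gaussianLaw.real (π.run f ⁻¹' π.longBatch i (b i) (b (i + 1))) := by
  by_contra! h
  have hU : (⋃ i ∈ Finset.range M, π.run f ⁻¹' π.longBatch i (b i) (b (i + 1))) = Set.univ := by
    refine Set.eq_univ_of_forall fun p => ?_
    obtain ⟨i, hi, hp⟩ := π.exists_mem_longBatch hM hb (π.run f p)
    exact Set.mem_iUnion₂.2 ⟨i, Finset.mem_range.2 hi, hp⟩
  have h1 := measureReal_biUnion_finset_le (μ := π.gaussianLaw) (Finset.range M)
    fun i => π.run f ⁻¹' π.longBatch i (b i) (b (i + 1))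
  rw [hU, probReal_univ] at h1
  have h2 := Finset.sum_lt_sum_of_nonempty (s := Finset.range M)
    (Finset.nonempty_range_iff.2 (by omega)) fun i hi => h i (Finset.mem_range.1 hi)
  have hM0 : (M : ℝ) ≠ 0 := by positivity
  simp only [Finset.sum_const, Finset.card_range, nsmul_eq_mul, mul_one_div_cancel hM0] at h2
  linarith

end BatchedPolicy

/-! ### Losses with a displaced minimizer -/

section BumpLoss

variable {X : Type*} [MetricSpace X] {q ρ : ℝ} {o a : X}

/-- The loss `dist · o ^ q`, modified on the ball of radius `ρ` around `a` so as to have its minimum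
at `a`. -/
def bumpLoss (q ρ : ℝ) (o a x : X) : ℝ :=
  if dist x a < ρ then dist x a ^ q - ρ ^ q else dist x o ^ q

lemma bumpLoss_self (hq : 1 ≤ q) (hρ : 0 < ρ) : bumpLoss q ρ o a a = -ρ ^ q := by
  simp [bumpLoss, hρ, Real.zero_rpow (by linarith : q ≠ 0)]

lemma bumpLoss_of_le {x : X} (hx : ρ ≤ dist x a) : bumpLoss q ρ o a x = dist x o ^ q :=
  if_neg hx.not_gt

/-- Inside the ball the excess loss is exactly `dist x a ^ q`. Outside it is `dist x o ^ q + ρ ^ q`: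
the lower bound uses `dist x a ≤ 2 max (dist x o) ρ`, the upper one `dist x o ≤ 2 dist x a`. The
possible jump across the sphere is harmless, as losses need only be Borel. -/
lemma isNondegenerateAt_bumpLoss (hq : 1 ≤ q) (hρ : 0 < ρ) (ha : dist a o = ρ) :
    IsNondegenerateAt (bumpLoss q ρ o a) a ((2 : ℝ) ^ (-q)) ((2 : ℝ) ^ q + 1) q := by
  have hq0 : 0 ≤ q := by linarith
  have h2q : (1 : ℝ) ≤ 2 ^ q := Real.one_le_rpow one_le_two hq0
  have h2nq : (2 : ℝ) ^ (-q) ≤ 1 := Real.rpow_le_one_of_one_le_of_nonpos one_le_two (by linarith)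
  have hinv : (2 : ℝ) ^ (-q) * 2 ^ q = 1 := by
    rw [← Real.rpow_add two_pos]; simp
  have hlow : ∀ x, (2 : ℝ) ^ (-q) * dist x a ^ q ≤ bumpLoss q ρ o a x - bumpLoss q ρ o a a := by
    intro x
    have hd : 0 ≤ dist x a ^ q := by positivity
    rw [bumpLoss_self hq hρ]
    rcases lt_or_ge (dist x a) ρ with h | h
    · rw [bumpLoss, if_pos h]
      nlinarith
    · rw [bumpLoss_of_le h]
      have htri : dist x a ≤ dist x o + ρ := by
        rw [← ha, dist_comm a o]; exact dist_triangle x o a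
      have ho : 0 ≤ dist x o ^ q := by positivity
      have hr : 0 ≤ ρ ^ q := by positivity
      have hmax : dist x a ^ q ≤ 2 ^ q * (dist x o ^ q + ρ ^ q) := by
        rcases le_total (dist x o) ρ with h' | h'
        · calc dist x a ^ q ≤ (2 * ρ) ^ q :=
                Real.rpow_le_rpow dist_nonneg (by linarith) hq0
            _ = 2 ^ q * ρ ^ q := Real.mul_rpow zero_le_two hρ.le
            _ ≤ _ := by nlinarith
        · calc dist x a ^ q ≤ (2 * dist x o) ^ q :=
                Real.rpow_le_rpow dist_nonneg (by linarith) hq0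
            _ = 2 ^ q * dist x o ^ q := Real.mul_rpow zero_le_two dist_nonneg
            _ ≤ _ := by nlinarith
      calc (2 : ℝ) ^ (-q) * dist x a ^ q ≤ 2 ^ (-q) * (2 ^ q * (dist x o ^ q + ρ ^ q)) := by gcongr
        _ = dist x o ^ q - -ρ ^ q := by rw [← mul_assoc, hinv]; ring
  refine ⟨by positivity, by linarith, hq, fun x hx => ?_, hlow, fun x => ?_⟩
  · have := hlow x
    have hpos : 0 < (2 : ℝ) ^ (-q) * dist x a ^ q :=
      mul_pos (by positivity) (Real.rpow_pos_of_pos (dist_pos.2 hx) q)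
    linarith
  · have hd : 0 ≤ dist x a ^ q := by positivity
    rw [bumpLoss_self hq hρ]
    rcases lt_or_ge (dist x a) ρ with h | h
    · rw [bumpLoss, if_pos h]
      nlinarith
    · rw [bumpLoss_of_le h]
      have h1 : dist x o ^ q ≤ 2 ^ q * dist x a ^ q := by
        rw [← Real.mul_rpow zero_le_two dist_nonneg]
        refine Real.rpow_le_rpow dist_nonneg ?_ hq0
        have := dist_triangle x a o
        linarith
      have h2 : ρ ^ q ≤ dist x a ^ q := Real.rpow_le_rpow hρ.le h hq0
      linarith

/-- The losses differ only in the ball, where `dist x a < ρ` and `dist x o ≤ 2ρ`. This caps the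
information carried by one sample. -/
lemma abs_bumpLoss_sub_le (hq : 1 ≤ q) (hρ : 0 < ρ) (ha : dist a o = ρ) (x : X) :
    |bumpLoss q ρ o a x - dist x o ^ q| ≤ ((2 : ℝ) ^ q + 1) * ρ ^ q := by
  have hr : 0 ≤ ρ ^ q := by positivity
  have hq0 : 0 ≤ q := by linarith
  rcases lt_or_ge (dist x a) ρ with h | h
  · rw [bumpLoss, if_pos h]
    have h1 : dist x a ^ q ≤ ρ ^ q := Real.rpow_le_rpow dist_nonneg h.le hq0
    have h2 : 0 ≤ dist x a ^ q := by positivity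
    have h3 : dist x o ^ q ≤ 2 ^ q * ρ ^ q := by
      rw [← Real.mul_rpow zero_le_two hρ.le]
      refine Real.rpow_le_rpow dist_nonneg ?_ hq0
      have := dist_triangle x a o
      linarith
    have h4 : 0 ≤ dist x o ^ q := by positivity
    have h5 : 0 ≤ (2 : ℝ) ^ q * ρ ^ q := by positivity
    rw [abs_le]; constructor <;> nlinarith
  · rw [bumpLoss_of_le h, sub_self, abs_zero]; positivity

lemma measurable_dist_rpow [MeasurableSpace X] [OpensMeasurableSpace X] (hq : 1 ≤ q) (o : X) :
    Measurable fun x : X => dist x o ^ q :=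
  ((continuous_id.dist continuous_const).rpow_const fun _ => .inr (by linarith)).measurable

lemma measurableSet_dist_lt [MeasurableSpace X] [OpensMeasurableSpace X] (a : X) (ρ : ℝ) :
    MeasurableSet {x : X | dist x a < ρ} := Metric.isOpen_ball.measurableSet

lemma measurable_bumpLoss [MeasurableSpace X] [OpensMeasurableSpace X] (hq : 1 ≤ q) :
    Measurable (bumpLoss q ρ o a) :=
  Measurable.ite (measurableSet_dist_lt a ρ) ((measurable_dist_rpow hq a).sub_const _)
    (measurable_dist_rpow hq o)

lemma hasSubgaussianMGF_gaussianReal :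
    HasSubgaussianMGF (fun z : ℝ => z) 1 (gaussianReal 0 1) where
  integrable_exp_mul t := integrable_exp_mul_gaussianReal t
  mgf_le t := by rw [mgf_fun_id_gaussianReal]; simp

/-- The instance with loss `bumpLoss` and standard Gaussian noise. -/
def bumpInstance [MeasurableSpace X] [OpensMeasurableSpace X] (hq : 1 ≤ q) (hρ : 0 < ρ)
    (ha : dist a o = ρ) :
    NondegenerateInstance X ((2 : ℝ) ^ (-q)) ((2 : ℝ) ^ q + 1) q where
  loss := bumpLoss q ρ o a
  opt := a
  measurable_loss := measurable_bumpLoss hq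
  nondegenerate := isNondegenerateAt_bumpLoss hq hρ ha
  noise := gaussianReal 0 1
  isProbabilityMeasure_noise := inferInstance
  noise_mean := integral_id_gaussianReal
  noise_subGaussian := hasSubgaussianMGF_gaussianReal

end BumpLoss

/-! ### Regret against a family of displaced minimizers -/

namespace BatchedPolicy

variable {X : Type*} [MetricSpace X] [MeasurableSpace X] {T M : ℕ}
  (π : BatchedPolicy X T M)

/-- The number of points played during the first `n` steps within distance `ρ` of `a`. -/
def visits (n : ℕ) (ρ : ℝ) (a : X) (p : π.Seed × (Fin T → ℝ)) : ℕ :=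
  ∑ t : Fin T, if (t : ℕ) < n ∧ dist (π.action p.1 p.2 t) a < ρ then 1 else 0

/-- There is a long batch, and at most half of the first `n` points are close to `a`. -/
def missed (i τ n : ℕ) (ρ : ℝ) (a : X) : Set (π.Seed × (Fin T → ℝ)) :=
  π.longBatch i τ n ∩ {p | 2 * π.visits n ρ a p ≤ n}

/-- Steps before `n ≤ t_{i+1}` belong to batches `0, …, i`, whose actions and endpoints use only
losses up to `t_i ≤ τ`. Hence the change of measure is paid for `τ` steps although the event
concerns `n` steps. -/
lemma mem_missed_of_forall_lt {i τ n : ℕ} (hi : i < M) {ρ : ℝ} {a : X} {u : π.Seed}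
    {y y' : Fin T → ℝ} (h : ∀ s : Fin T, (s : ℕ) < τ → y s = y' s)
    (hy : (u, y) ∈ π.missed i τ n ρ a) : (u, y') ∈ π.missed i τ n ρ a := by
  obtain ⟨⟨h1, h2⟩, h3⟩ := hy
  simp only at h1 h2
  have hlt : ∀ j ≤ i, ∀ s : Fin T, (s : ℕ) < π.grid u y j → y s = y' s := fun j hj s hs =>
    h s (hs.trans_le ((π.grid_monotone u y hj hi.le).trans h1))
  have hg : ∀ j ≤ i, π.grid u y (j + 1) = π.grid u y' (j + 1) := fun j hj =>
    π.grid_adapted u y y' j (by omega) (hlt j hj)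
  have hgi : π.grid u y i = π.grid u y' i := by
    rcases i with _ | i
    · rw [π.grid_zero, π.grid_zero]
    · exact hg i (by omega)
  have ha : ∀ t : Fin T, (t : ℕ) < n → π.action u y t = π.action u y' t := fun t ht => by
    obtain ⟨j, hj, h4, h5⟩ := π.exists_batch u y t.2
    have hji : j ≤ i := by
      by_contra hlt
      have := π.grid_monotone u y (show i + 1 ≤ j by omega) hj.le
      omega
    exact π.action_adapted u y y' j hj t h4 h5 (hlt j hji)
  have hv : π.visits n ρ a (u, y) = π.visits n ρ a (u, y') := by
    refine Finset.sum_congr rfl fun t _ => ?_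
    by_cases ht : (t : ℕ) < n
    · simp only [ha t ht]
    · simp [ht]
  refine ⟨⟨?_, ?_⟩, ?_⟩
  · simpa only [← hgi] using h1
  · simpa only [← hg i le_rfl] using h2
  · simp only [Set.mem_ofPred_eq, ← hv]; exact h3

variable {q ρ : ℝ} {o : X}

lemma card_filter_val_lt_le (τ : ℕ) :
    (∑ t : Fin T, if (t : ℕ) < τ then (1 : ℝ) else 0) ≤ τ := by
  rw [Fin.sum_univ_eq_sum_range (fun t => if t < τ then (1 : ℝ) else 0), ← Finset.sum_filter]
  simp only [Finset.sum_const, nsmul_eq_mul, mul_one, Nat.cast_le]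
  calc _ ≤ (Finset.range τ).card := Finset.card_le_card fun t ht => by simp_all
    _ = τ := Finset.card_range τ

lemma card_filter_val_lt_eq {n : ℕ} (hn : n ≤ T) :
    (∑ t : Fin T, if (t : ℕ) < n then (1 : ℝ) else 0) = n := by
  rw [Fin.sum_univ_eq_sum_range (fun t => if t < n then (1 : ℝ) else 0), ← Finset.sum_filter]
  have : (Finset.range T).filter (· < n) = Finset.range n := by
    ext t; simp; omega
  simp [this]

/-- On `missed`, the regret is at least proportional to the number of steps. -/
lemma le_regret_of_mem_missed (hq : 1 ≤ q) (hρ : 0 < ρ) {a : X} (ha : dist a o = ρ)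
    {i τ n : ℕ} (hn : n ≤ T) {p : π.Seed × (Fin T → ℝ)}
    (hp : π.run (bumpLoss q ρ o a) p ∈ π.missed i τ n ρ a) :
    (n / 2 : ℝ) * ρ ^ q ≤ ∑ t : Fin T,
      (bumpLoss q ρ o a (π.played (bumpLoss q ρ o a) p.1 p.2 t) - bumpLoss q ρ o a a) := by
  have hv : 2 * π.visits n ρ a (π.run (bumpLoss q ρ o a) p) ≤ n := hp.2
  have hv' : 2 * (π.visits n ρ a (π.run (bumpLoss q ρ o a) p) : ℝ) ≤ n := by exact_mod_cast hv
  have hr : 0 < ρ ^ q := Real.rpow_pos_of_pos hρ q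
  have hnd := isNondegenerateAt_bumpLoss hq hρ ha
  have hge : ∑ t : Fin T, ρ ^ q * ((if (t : ℕ) < n then (1 : ℝ) else 0) -
      (if (t : ℕ) < n ∧ dist (π.played (bumpLoss q ρ o a) p.1 p.2 t) a < ρ then 1 else 0)) ≤
      ∑ t : Fin T, (bumpLoss q ρ o a (π.played (bumpLoss q ρ o a) p.1 p.2 t) -
        bumpLoss q ρ o a a) := by
    refine Finset.sum_le_sum fun t _ => ?_
    set x := π.played (bumpLoss q ρ o a) p.1 p.2 t
    have h0 : 0 ≤ bumpLoss q ρ o a x - bumpLoss q ρ o a a :=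
      le_trans (by positivity) (hnd.lower x)
    by_cases h1 : (t : ℕ) < n
    · by_cases h2 : dist x a < ρ
      · simpa [h1, h2] using h0
      · simp only [h1, h2, and_false, if_true, if_false, sub_zero, mul_one]
        rw [bumpLoss_of_le (not_lt.1 h2), bumpLoss_self hq hρ]
        have : 0 ≤ dist x o ^ q := by positivity
        linarith
    · simpa [h1] using h0
  refine le_trans ?_ hge
  rw [← Finset.mul_sum, Finset.sum_sub_distrib, card_filter_val_lt_eq hn]
  have : (π.visits n ρ a (π.run (bumpLoss q ρ o a) p) : ℝ) =
      ∑ t : Fin T, if (t : ℕ) < n ∧ dist (π.played (bumpLoss q ρ o a) p.1 p.2 t) a < ρ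
        then (1 : ℝ) else 0 := by
    rw [visits, Nat.cast_sum]
    refine Finset.sum_congr rfl fun t _ => ?_
    rw [Nat.cast_ite, Nat.cast_one, Nat.cast_zero]
    rfl
  rw [← this]
  nlinarith

variable [BorelSpace X]

lemma measurable_visits (n : ℕ) (ρ : ℝ) (a : X) : Measurable (π.visits n ρ a) := by
  refine Finset.measurable_sum _ fun t _ => ?_
  refine Measurable.ite ?_ measurable_const measurable_const
  exact (MeasurableSet.const _).inter (π.measurable_action t (measurableSet_dist_lt a ρ))

lemma measurableSet_missed (i τ n : ℕ) (ρ : ℝ) (a : X) : MeasurableSet (π.missed i τ n ρ a) :=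
  (π.measurableSet_longBatch i τ n).inter
    (measurableSet_le ((π.measurable_visits n ρ a).const_mul 2) measurable_const)

/-- Markov's inequality. Compactness bounds the regret and so makes it integrable; otherwise the
Bochner integral would default to `0`. -/
lemma le_expectedRegret_bumpInstance [CompactSpace X] (hq : 1 ≤ q) (hρ : 0 < ρ) {a : X}
    (ha : dist a o = ρ) {i τ n : ℕ} (hn : n ≤ T) :
    (n / 2 : ℝ) * ρ ^ q * π.gaussianLaw.real (π.run (bumpLoss q ρ o a) ⁻¹' π.missed i τ n ρ a) ≤
      expectedRegret π (bumpInstance hq hρ ha) := by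
  set f := bumpLoss q ρ o a
  have hnd := isNondegenerateAt_bumpLoss hq hρ ha
  have hfm : Measurable f := measurable_bumpLoss hq
  set E := π.run f ⁻¹' π.missed i τ n ρ a
  have hE : MeasurableSet E := π.measurable_run hfm (π.measurableSet_missed i τ n ρ a)
  have h0 (x : X) : 0 ≤ f x - f a := le_trans (by positivity) (hnd.lower x)
  have hint : Integrable (fun p : π.Seed × (Fin T → ℝ) =>
      ∑ t : Fin T, (f (π.played f p.1 p.2 t) - f a)) π.gaussianLaw := by
    refine integrable_finsetSum _ fun t _ => ?_
    refine Integrable.of_bound (C := ((2 : ℝ) ^ q + 1) * Metric.diam (Set.univ : Set X) ^ q)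
      ((hfm.comp (π.measurable_played hfm t)).sub_const _).aestronglyMeasurable
      (.of_forall fun p => ?_)
    rw [Real.norm_eq_abs, abs_of_nonneg (h0 _)]
    refine (hnd.upper _).trans ?_
    gcongr
    exact Metric.dist_le_diam_of_mem isCompact_univ.isBounded (Set.mem_univ _) (Set.mem_univ _)
  have hle : ∫ p, E.indicator (fun _ => (n / 2 : ℝ) * ρ ^ q) p ∂π.gaussianLaw ≤
      ∫ p, ∑ t : Fin T, (f (π.played f p.1 p.2 t) - f a) ∂π.gaussianLaw := by
    refine integral_mono ((integrable_const _).indicator hE) hint fun p => ?_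
    by_cases hp : p ∈ E
    · rw [Set.indicator_of_mem hp]
      exact π.le_regret_of_mem_missed hq hρ ha hn hp
    · rw [Set.indicator_of_notMem hp]
      exact Finset.sum_nonneg fun t _ => h0 _
  rw [integral_indicator_const _ hE, smul_eq_mul, mul_comm] at hle
  exact hle

/-- If the policy is likely to make a long batch when the minimizer is at `o`, then it incurs a large
regret for one of the minimizers `a k`. -/
theorem exists_le_expectedRegret [CompactSpace X] {ι : Type*} [Fintype ι]
    (hι : 2 ≤ Fintype.card ι) (hq : 1 ≤ q) (hρ : 0 < ρ) (a : ι → X) (ha : ∀ k, dist (a k) o = ρ)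
    (hsep : ∀ k l, k ≠ l → 2 * ρ ≤ dist (a k) (a l)) {i τ n : ℕ} (hi : i < M) (hn : n ≤ T)
    {r : ℝ} (hr : r ≤ π.gaussianLaw.real (π.run (fun x => dist x o ^ q) ⁻¹' π.longBatch i τ n))
    (hτ : (((2 : ℝ) ^ q + 1) * ρ ^ q) ^ 2 * τ ≤ Fintype.card ι * r / 2) :
    ∃ k, (n / 2 : ℝ) * ρ ^ q * (r / 8) ≤ expectedRegret π (bumpInstance hq hρ (ha k)) := by
  classical
  set f₀ : X → ℝ := fun x => dist x o ^ q
  set f : ι → X → ℝ := fun k => bumpLoss q ρ o (a k)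
  set C : ℝ := ((2 : ℝ) ^ q + 1) * ρ ^ q
  set N : ℝ := (Fintype.card ι : ℝ)
  have hN : (2 : ℝ) ≤ N := Nat.ofNat_le_cast.2 hι
  have hf₀ : Measurable f₀ := measurable_dist_rpow hq o
  have hf (k) : Measurable (f k) := measurable_bumpLoss hq
  have hC (k) (x : X) : |f k x - f₀ x| ≤ C := abs_bumpLoss_sub_le hq hρ (ha k) x
  have hdisj (x : X) {k l : ι} (hk : dist x (a k) < ρ) (hl : dist x (a l) < ρ) : k = l := by
    by_contra hne
    have := hsep k l hne
    have := dist_triangle_left (a k) (a l) x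
    linarith
  set A := π.run f₀ ⁻¹' π.longBatch i τ n
  set B : ι → Set (π.Seed × (Fin T → ℝ)) := fun k => π.run f₀ ⁻¹' π.missed i τ n ρ (a k)
  have hAm : MeasurableSet A := π.measurable_run hf₀ (π.measurableSet_longBatch i τ n)
  have hBm (k) : MeasurableSet (B k) := π.measurable_run hf₀ (π.measurableSet_missed i τ n ρ (a k))
  have hBA (k) : B k ⊆ A := Set.preimage_mono Set.inter_subset_left
  -- At most one arm can be visited in more than half of the steps.
  have hB : (N - 1) * π.gaussianLaw.real A ≤ ∑ k, π.gaussianLaw.real (B k) := by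
    have hd : ((Finset.univ : Finset ι) : Set ι).PairwiseDisjoint fun k => A \ B k := by
      intro k _ l _ hkl
      rw [Function.onFun, Set.disjoint_left]
      rintro p ⟨hpA, hpk⟩ ⟨-, hpl⟩
      have h1 : n < 2 * π.visits n ρ (a k) (π.run f₀ p) := by
        by_contra h; exact hpk ⟨hpA, not_lt.1 h⟩
      have h2 : n < 2 * π.visits n ρ (a l) (π.run f₀ p) := by
        by_contra h; exact hpl ⟨hpA, not_lt.1 h⟩
      have h3 : ((π.visits n ρ (a k) (π.run f₀ p) + π.visits n ρ (a l) (π.run f₀ p) : ℕ) : ℝ)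
          ≤ n := by
        refine le_trans ?_ (card_filter_val_lt_le (T := T) n)
        rw [visits, visits, ← Finset.sum_add_distrib, Nat.cast_sum]
        refine Finset.sum_le_sum fun t _ => ?_
        by_cases ht : (t : ℕ) < n
        · by_cases hk : dist (π.action (π.run f₀ p).1 (π.run f₀ p).2 t) (a k) < ρ
          · have hl : ¬ dist (π.action (π.run f₀ p).1 (π.run f₀ p).2 t) (a l) < ρ :=
              fun hl => hkl (hdisj _ hk hl)
            simp [ht, hk, hl]
          · simp only [ht, hk, and_false, if_false, zero_add, if_true, true_and]
            split_ifs <;> simp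
        · simp [ht]
      have h4 : π.visits n ρ (a k) (π.run f₀ p) + π.visits n ρ (a l) (π.run f₀ p) ≤ n := by
        exact_mod_cast h3
      omega
    have hsum := measureReal_biUnion_finset (μ := π.gaussianLaw) hd
      (fun k _ => hAm.diff (hBm k))
    have hle : π.gaussianLaw.real (⋃ k ∈ (Finset.univ : Finset ι), A \ B k) ≤
        π.gaussianLaw.real A :=
      measureReal_mono (Set.iUnion₂_subset fun k _ => Set.sdiff_subset)
    rw [hsum] at hle
    have hdiff (k) : π.gaussianLaw.real (A \ B k) =
        π.gaussianLaw.real A - π.gaussianLaw.real (B k) := measureReal_sdiff (hBA k) (hBm k)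
    simp only [hdiff, Finset.sum_sub_distrib, Finset.sum_const,
      Finset.card_univ, nsmul_eq_mul] at hle
    change N * _ - _ ≤ _ at hle
    linarith
  set V : ι → ℝ := fun k => ∫ p, ∑ t : Fin T, (if (t : ℕ) < τ then
    (f k (π.played f₀ p.1 p.2 t) - f₀ (π.played f₀ p.1 p.2 t)) ^ 2 else 0) ∂π.gaussianLaw
  -- Each played point lies in at most one ball, so the sum over all candidates costs no more than
  -- one of them. This is the source of the exponential gain in the dimension.
  have hV : ∑ k, V k ≤ C ^ 2 * τ := by
    have hVi (k) := π.integrable_sum_sq hf₀ (hf k) (hC k) τ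
    rw [← integral_finsetSum _ fun k _ => hVi k]
    have hx (x : X) : ∑ k, (f k x - f₀ x) ^ 2 ≤ C ^ 2 := by
      by_cases h : ∃ k, dist x (a k) < ρ
      · obtain ⟨k, hk⟩ := h
        rw [Finset.sum_eq_single k]
        · rw [← sq_abs]
          exact pow_le_pow_left₀ (abs_nonneg _) (hC k x) 2
        · intro l _ hl
          have : ρ ≤ dist x (a l) := not_lt.1 fun h => hl (hdisj x h hk)
          simp [f, f₀, bumpLoss_of_le this]
        · simp
      · push Not at h
        rw [Finset.sum_eq_zero]
        · positivity
        · intro l _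
          simp [f, f₀, bumpLoss_of_le (h l)]
    have hpt (p : π.Seed × (Fin T → ℝ)) : ∑ k, ∑ t : Fin T, (if (t : ℕ) < τ then
        (f k (π.played f₀ p.1 p.2 t) - f₀ (π.played f₀ p.1 p.2 t)) ^ 2 else 0) ≤ C ^ 2 * τ := by
      rw [Finset.sum_comm]
      calc _ ≤ ∑ t : Fin T, C ^ 2 * (if (t : ℕ) < τ then (1 : ℝ) else 0) := by
            refine Finset.sum_le_sum fun t _ => ?_
            split_ifs
            · rw [mul_one]; exact hx _
            · simp
        _ ≤ C ^ 2 * τ := by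
            rw [← Finset.mul_sum]
            exact mul_le_mul_of_nonneg_left (card_filter_val_lt_le τ) (by positivity)
    calc _ ≤ ∫ _, C ^ 2 * τ ∂π.gaussianLaw :=
          integral_mono (integrable_finsetSum _ fun k _ => hVi k) (integrable_const _) hpt
      _ = C ^ 2 * τ := by simp
  set Q : ι → ℝ := fun k => π.gaussianLaw.real (π.run (f k) ⁻¹' π.missed i τ n ρ (a k))
  have hcm (k) : π.gaussianLaw.real (B k) - V k / 2 ≤ (Real.exp 1 - 1) * Q k :=
    π.measureReal_run_preimage_le hf₀ (hf k) (hC k) τ (π.measurableSet_missed i τ n ρ (a k))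
      fun u y y' h => π.mem_missed_of_forall_lt hi h
  have hcm' : ∀ k, π.gaussianLaw.real (B k) - V k / 2 ≤ 2 * Q k := fun k => by
    have h1 := hcm k
    have h2 : 0 ≤ Q k := measureReal_nonneg
    have := Real.exp_one_lt_d9
    nlinarith
  have hr0 : 0 ≤ r := by
    have : 0 ≤ N * r / 2 := le_trans (by positivity) hτ
    by_contra h
    nlinarith
  -- The sum is at least `(N - 1) r - N r / 4`, and `N - 1 ≥ N / 2` because `N ≥ 2`.
  have htot : N * r / 4 ≤ ∑ k, 2 * Q k := by
    have h1 := Finset.sum_le_sum fun k (_ : k ∈ Finset.univ) => hcm' k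
    rw [Finset.sum_sub_distrib, ← Finset.sum_div] at h1
    nlinarith
  obtain ⟨k, hk⟩ : ∃ k, r / 8 ≤ Q k := by
    by_contra! h
    have hne : (Finset.univ : Finset ι).Nonempty := by
      rw [← Finset.card_pos, Finset.card_univ]; omega
    have := Finset.sum_lt_sum_of_nonempty hne fun k _ =>
      (mul_lt_mul_of_pos_left (h k) two_pos)
    rw [Finset.sum_const, Finset.card_univ, nsmul_eq_mul] at this
    change _ < N * _ at this
    linarith
  refine ⟨k, le_trans ?_ (π.le_expectedRegret_bumpInstance hq hρ (ha k) hn (i := i) (τ := τ))⟩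
  exact mul_le_mul_of_nonneg_left hk (by positivity)

end BatchedPolicy

/-! ### Doubling dimension of the sup-metric cube -/

section Cube

/-- The cube `[-R, R]ⁿ` with the sup metric. -/
abbrev Cube (n : ℕ) (R : ℝ) : Type := Fin n → Set.Icc (-R) R

variable {n : ℕ} {R : ℝ}

/-- The point of the cube with coordinates `±ρ`. -/
def cubeVertex {ρ : ℝ} (hρ : 0 ≤ ρ) (hR : ρ ≤ R) (ε : Fin n → Bool) : Cube n R :=
  fun i => if ε i then ⟨ρ, by linarith, hR⟩ else ⟨-ρ, by linarith, by linarith⟩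

/-- The centre of the cube. -/
def cubeCenter (n : ℕ) (hR : 0 ≤ R) : Cube n R := fun _ => ⟨0, by linarith, hR⟩

lemma two_mul_le_dist_cubeVertex {ρ : ℝ} (hρ : 0 ≤ ρ) (hR : ρ ≤ R) {ε ε' : Fin n → Bool}
    (h : ε ≠ ε') : 2 * ρ ≤ dist (cubeVertex hρ hR ε) (cubeVertex hρ hR ε') := by
  obtain ⟨i, hi⟩ := Function.ne_iff.1 h
  refine le_trans ?_ (dist_le_pi_dist _ _ i)
  rw [Subtype.dist_eq, Real.dist_eq]
  cases h1 : ε i <;> cases h2 : ε' i <;> simp_all [cubeVertex]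
  · rw [show -ρ - ρ = -(2 * ρ) by ring, abs_neg]; exact le_abs_self _
  · rw [← two_mul]; exact le_abs_self _

lemma dist_cubeVertex_cubeCenter [NeZero n] {ρ : ℝ} (hρ : 0 ≤ ρ) (hR : ρ ≤ R)
    (ε : Fin n → Bool) :
    dist (cubeVertex hρ hR ε) (cubeCenter n (hρ.trans hR)) = ρ := by
  have key (i : Fin n) : dist (cubeVertex hρ hR ε i) (cubeCenter n (hρ.trans hR) i) = ρ := by
    rw [Subtype.dist_eq, Real.dist_eq]
    cases h : ε i <;> simp [cubeVertex, cubeCenter, h, abs_of_nonneg hρ]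
  refine le_antisymm ((dist_pi_le_iff hρ).2 fun i => (key i).le) ?_
  exact (key 0).symm.le.trans (dist_le_pi_dist _ _ 0)

/-- A sup-ball splits into `2ⁿ` orthants, each a ball of half the radius centred at `x ± r/2`
coordinatewise. Clamping the centres to the cube preserves the cover. -/
lemma doublingWith_cube (hR : 0 ≤ R) : DoublingWith (Cube n R) (2 ^ n) := by
  classical
  intro x r hr
  have hRR : -R ≤ R := by linarith
  let z : (Fin n → Bool) → Cube n R := fun ε i =>
    Set.projIcc (-R) R hRR (if ε i then (x i : ℝ) + r / 2 else (x i : ℝ) - r / 2)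
  refine ⟨Finset.univ.image z, Finset.card_image_le.trans (by simp), fun y hy => ?_⟩
  rw [Metric.mem_closedBall, dist_pi_le_iff hr.le] at hy
  simp only [Finset.mem_image, Finset.mem_univ, true_and, Set.iUnion_exists,
    Set.iUnion_iUnion_eq', Set.mem_iUnion, Metric.mem_closedBall]
  refine ⟨fun i => decide (x i ≤ y i), (dist_pi_le_iff (by linarith)).2 fun i => ?_⟩
  have hi := hy i
  rw [Subtype.dist_eq, Real.dist_eq, abs_le] at hi ⊢
  have hy1 := (y i).2.1
  have hy2 := (y i).2.2
  have hx1 := (x i).2.1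
  have hx2 := (x i).2.2
  by_cases h : x i ≤ y i
  · have h' : (x i : ℝ) ≤ y i := h
    simp only [z, h, decide_true, if_true, Set.coe_projIcc]
    rw [max_eq_right (le_min hRR (by linarith))]
    rcases min_cases R ((x i : ℝ) + r / 2) with ⟨h1, h2⟩ | ⟨h1, h2⟩ <;> rw [h1] <;>
      constructor <;> linarith
  · have h' : (y i : ℝ) < x i := not_le.1 h
    simp only [z, h, decide_false, Bool.false_eq_true, if_false, Set.coe_projIcc]
    rw [min_eq_right (by linarith)]
    rcases max_cases (-R) ((x i : ℝ) - r / 2) with ⟨h1, h2⟩ | ⟨h1, h2⟩ <;> rw [h1] <;>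
      constructor <;> linarith

/-- The `2ⁿ` vertices lie in the ball of radius `R` about the centre and are `2R` apart, so a ball
of radius `R / 2` holds at most one. -/
lemma two_pow_le_of_doublingWith_cube [NeZero n] (hR : 0 < R) {N : ℕ}
    (h : DoublingWith (Cube n R) N) : 2 ^ n ≤ N := by
  obtain ⟨c, hc, hcov⟩ := h (cubeCenter n hR.le) R hR
  have hv (ε : Fin n → Bool) : ∃ z ∈ c, dist (cubeVertex hR.le le_rfl ε) z ≤ R / 2 := by
    have := hcov (Metric.mem_closedBall.2 (dist_cubeVertex_cubeCenter hR.le le_rfl ε).le)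
    simpa using this
  choose z hz hd using hv
  have hinj : Function.Injective z := by
    intro ε ε' he
    by_contra hne
    have h1 := two_mul_le_dist_cubeVertex hR.le le_rfl hne
    have h2 := dist_triangle_right (cubeVertex hR.le le_rfl ε) (cubeVertex hR.le le_rfl ε') (z ε)
    have h3 := hd ε
    have h4 := hd ε'
    rw [← he] at h4
    linarith
  have := Finset.card_le_card_of_injOn (s := Finset.univ) z (fun ε _ => hz ε) hinj.injOn
  simp only [Finset.card_univ, Fintype.card_fun, Fintype.card_bool, Fintype.card_fin] at this
  exact this.trans hc

lemma doublingDim_cube [NeZero n] (hR : 0 < R) : doublingDim (Cube n R) = n := by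
  have : doublingConstant (Cube n R) = 2 ^ n :=
    le_antisymm (Nat.sInf_le (doublingWith_cube hR.le))
      (le_csInf ⟨_, doublingWith_cube hR.le⟩ fun _ h => two_pow_le_of_doublingWith_cube hR h)
  rw [doublingDim, this, Nat.cast_pow, Real.logb_pow]
  simp

end Cube

/-! ### Cutoffs and choice of parameters -/

section Cutoffs

/-- The cutoffs for the communication points, `T ^ ((1 - 2⁻ⁱ) / (1 - 2⁻ᴹ))`. -/
def cutoff (T M i : ℕ) : ℝ := (T : ℝ) ^ ((1 - 1 / (2 : ℝ) ^ i) * (1 / (1 - 1 / (2 : ℝ) ^ M)))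

variable {T M : ℕ}

lemma one_sub_one_div_two_pow_pos (hM : 1 ≤ M) : 0 < 1 - 1 / (2 : ℝ) ^ M := by
  have : (1 : ℝ) < 2 ^ M := one_lt_pow₀ one_lt_two (by omega)
  rw [sub_pos, div_lt_one (by positivity)]
  exact this

lemma cutoff_last (hM : 1 ≤ M) : cutoff T M M = T := by
  rw [cutoff, mul_one_div_cancel (one_sub_one_div_two_pow_pos hM).ne', Real.rpow_one]

lemma one_le_cutoff (hM : 1 ≤ M) (hT : 1 ≤ T) (i : ℕ) : 1 ≤ cutoff T M i := by
  refine Real.one_le_rpow (by exact_mod_cast hT) (mul_nonneg ?_ ?_)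
  · rw [sub_nonneg, div_le_one (by positivity)]
    exact one_le_pow₀ one_le_two
  · exact (one_div_pos.2 (one_sub_one_div_two_pow_pos hM)).le

/-- Since `1 - 2^{-(i+1)} = 1/2 + (1 - 2^{-i})/2`, the ratio of a cutoff to the root of its
predecessor is the same for all `i`: no batch is a better place to be long. -/
lemma cutoff_succ (hT : 1 ≤ T) (i : ℕ) :
    cutoff T M (i + 1) =
      (T : ℝ) ^ ((1 / 2 : ℝ) * (1 / (1 - 1 / (2 : ℝ) ^ M))) * √(cutoff T M i) := by
  have hT0 : (0 : ℝ) < T := by exact_mod_cast hT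
  rw [Real.sqrt_eq_rpow, cutoff, cutoff, ← Real.rpow_mul hT0.le, ← Real.rpow_add hT0]
  congr 1
  rw [pow_succ, ← one_div_mul_one_div]
  ring

end Cutoffs

/-- The regret lower bound on the cube `[-2ⁿ, 2ⁿ]ⁿ`. -/
theorem exists_le_expectedRegret_cube {n : ℕ} [NeZero n] {q : ℝ} (hq : 1 ≤ q) {M T : ℕ}
    (hM : 1 ≤ M) (hMT : M ≤ T) (π : BatchedPolicy (Cube n (2 ^ n)) T M) :
    ∃ I : NondegenerateInstance (Cube n (2 ^ n)) ((2 : ℝ) ^ (-q)) ((2 : ℝ) ^ q + 1) q,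
      1 / (32 * ((2 : ℝ) ^ q + 1)) * √2 ^ n * (1 / (M : ℝ) ^ 2) *
        (T : ℝ) ^ ((1 / 2 : ℝ) * (1 / (1 - 1 / (2 : ℝ) ^ M))) ≤ expectedRegret π I := by
  set L : ℝ := (2 : ℝ) ^ q + 1
  set V : ℝ := (T : ℝ) ^ ((1 / 2 : ℝ) * (1 / (1 - 1 / (2 : ℝ) ^ M)))
  have hT : 1 ≤ T := hM.trans hMT
  have hL : 1 ≤ L := by
    have : 0 < (2 : ℝ) ^ q := by positivity
    simp only [L]; linarith
  have hR : (0 : ℝ) < 2 ^ n := by positivity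
  have hR1 : (1 : ℝ) ≤ 2 ^ n := one_le_pow₀ one_le_two
  have hM1 : (1 : ℝ) ≤ M := by exact_mod_cast hM
  set o : Cube n (2 ^ n) := cubeCenter n hR.le
  obtain ⟨i, hi, hprob⟩ := π.exists_le_measureReal_longBatch hM
    (b := fun i => ⌈cutoff T M i⌉₊) (by simp [cutoff_last hM]) (f := fun x => dist x o ^ q)
  set S := cutoff T M i
  have hS : 1 ≤ S := one_le_cutoff hM hT i
  have hS1 : cutoff T M (i + 1) = V * √S := cutoff_succ hT i
  -- Solves `(L δ)² * 2S = 2ⁿ / (2M)`, the information budget after `⌈S⌉ ≤ 2S`. It is to be `ρ ^ q`.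
  set δ : ℝ := √2 ^ n / (2 * √M * √S * L)
  have hδ : 0 < δ := by positivity
  have hs2 : (1 : ℝ) ≤ √2 ^ n := one_le_pow₀ (Real.one_le_sqrt.2 one_le_two)
  have hs2' : (√2 ^ n) ^ 2 = (2 : ℝ) ^ n := by
    rw [← pow_mul, mul_comm, pow_mul, Real.sq_sqrt zero_le_two]
  have hsM : 1 ≤ √(M : ℝ) := Real.one_le_sqrt.2 hM1
  have hsS : 1 ≤ √S := Real.one_le_sqrt.2 hS
  have hδR : δ ≤ 2 ^ n := by
    have hden : 1 ≤ 2 * √M * √S * L :=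
      one_le_mul_of_one_le_of_one_le (one_le_mul_of_one_le_of_one_le (by linarith) hsS) hL
    calc δ ≤ √2 ^ n := div_le_self (by positivity) hden
      _ ≤ 2 ^ n := by nlinarith
  have hq0 : 0 < q := by linarith
  set ρ : ℝ := δ ^ (1 / q)
  have hρ : 0 < ρ := by positivity
  have hρq : ρ ^ q = δ := by
    rw [← Real.rpow_mul hδ.le, one_div_mul_cancel hq0.ne', Real.rpow_one]
  -- The side length `2ⁿ` is chosen for this: the vertices fit into the cube for every `q ≥ 1`, so
  -- the space does not depend on `q`.
  have hρR : ρ ≤ 2 ^ n := by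
    calc ρ ≤ ((2 : ℝ) ^ n) ^ (1 / q) := Real.rpow_le_rpow hδ.le hδR (by positivity)
      _ ≤ ((2 : ℝ) ^ n) ^ (1 : ℝ) :=
        Real.rpow_le_rpow_of_exponent_le hR1 ((div_le_one hq0).2 hq)
      _ = 2 ^ n := Real.rpow_one _
  have hcard : Fintype.card (Fin n → Bool) = 2 ^ n := by simp
  have hsucc : ⌈cutoff T M (i + 1)⌉₊ ≤ T := by
    refine Nat.ceil_le.2 ?_
    rw [← cutoff_last (T := T) hM]
    refine Real.rpow_le_rpow_of_exponent_le (by exact_mod_cast hT)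
      (mul_le_mul_of_nonneg_right ?_ (one_div_pos.2 (one_sub_one_div_two_pow_pos hM)).le)
    have : (2 : ℝ) ^ (i + 1) ≤ 2 ^ M := pow_le_pow_right₀ one_le_two hi
    have := one_div_le_one_div_of_le (by positivity) this
    linarith
  obtain ⟨k, hk⟩ := π.exists_le_expectedRegret (ι := Fin n → Bool)
    (by rw [hcard]; exact Nat.le_self_pow (NeZero.ne n) 2) hq hρ (cubeVertex hρ.le hρR)
    (fun ε => dist_cubeVertex_cubeCenter hρ.le hρR ε)
    (fun ε ε' h => two_mul_le_dist_cubeVertex hρ.le hρR h) hi hsucc hprob (by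
      have hceil : (⌈S⌉₊ : ℝ) ≤ 2 * S := by
        have := Nat.ceil_lt_add_one (zero_le_one.trans hS)
        linarith
      rw [hρq, hcard, Nat.cast_pow, Nat.cast_ofNat]
      calc (L * δ) ^ 2 * (⌈S⌉₊ : ℝ) ≤ (L * δ) ^ 2 * (2 * S) := by gcongr
        _ = ((√2 ^ n) ^ 2 / (4 * √M ^ 2 * √S ^ 2)) * (2 * S) := by
          simp only [δ]; field_simp; ring
        _ = 2 ^ n * (1 / M) / 2 := by
          rw [hs2', Real.sq_sqrt (by positivity), Real.sq_sqrt (by positivity)]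
          field_simp; ring)
  refine ⟨_, le_trans ?_ hk⟩
  rw [hρq]
  have hV : 0 ≤ V := by positivity
  -- The argument gives `M ^ (-3/2)`, which is weakened to `M ^ (-2)`.
  calc 1 / (32 * L) * √2 ^ n * (1 / (M : ℝ) ^ 2) * V
      ≤ 1 / (32 * L) * √2 ^ n * (1 / (M * √M)) * V := by
        have : (M : ℝ) * √M ≤ M ^ 2 := by
          rw [sq]
          refine mul_le_mul_of_nonneg_left ?_ (by positivity)
          exact Real.sqrt_le_self_iff.2 (.inr hM1)
        gcongr
    _ = V * √S / 2 * δ * (1 / M / 8) := by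
        simp only [δ]; field_simp; ring
    _ ≤ (⌈cutoff T M (i + 1)⌉₊ : ℝ) / 2 * δ * (1 / M / 8) := by
        rw [← hS1]
        gcongr
        exact Nat.le_ceil _

end

theorem theorem3 :
    ∃ A : ℝ, 1 < A ∧
    ∀ q : ℝ, 1 ≤ q →
    ∃ lam L K : ℝ, 0 < lam ∧ lam ≤ L ∧ 0 < K ∧
    ∀ d : ℝ, 1 ≤ d →
    ∃ (X : Type) (_ : MetricSpace X) (_ : MeasurableSpace X) (_ : BorelSpace X),
      CompactSpace X ∧ IsDoubling X ∧ doublingDim X = (⌊d⌋₊ : ℝ) ∧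
      ∀ M T : ℕ, 1 ≤ M → M ≤ T →
      ∀ π : BatchedPolicy X T M,
      ∃ I : NondegenerateInstance X lam L q,
        K * A ^ ⌊d⌋₊ * (1 / (M : ℝ) ^ 2) *
            (T : ℝ) ^ ((1 / 2 : ℝ) * (1 / (1 - 1 / (2 : ℝ) ^ M))) ≤
          expectedRegret π I := by
  refine ⟨√2, Real.lt_sqrt_of_sq_lt (by norm_num), fun q hq =>
    ⟨2 ^ (-q), 2 ^ q + 1, 1 / (32 * (2 ^ q + 1)), by positivity, ?_, by positivity, fun d hd => ?_⟩⟩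
  · have h1 : (2 : ℝ) ^ (-q) ≤ 1 :=
      Real.rpow_le_one_of_one_le_of_nonpos one_le_two (by linarith)
    have h2 : (0 : ℝ) < 2 ^ q := by positivity
    linarith
  -- In dimension `0` the vertices would coincide with the centre; `d ≥ 1` excludes this.
  · have : NeZero ⌊d⌋₊ := ⟨(Nat.floor_pos.2 hd).ne'⟩
    have hR : (0 : ℝ) < 2 ^ ⌊d⌋₊ := by positivity
    exact ⟨Cube ⌊d⌋₊ (2 ^ ⌊d⌋₊), inferInstance, inferInstance, inferInstance, inferInstance,
      ⟨_, doublingWith_cube hR.le⟩, doublingDim_cube hR,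
      fun M T hM hMT π => exists_le_expectedRegret_cube hq hM hMT π⟩
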